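/- Let $M$ be a von Neumann algebra equipped with a faithful normal trace $\tau$ satisfying $\tau(1)=1$ (so $M$ is finite), and let $B\subseteq M$ be a von Neumann subalgebra with the same unit as $M$. Let $L^2(M)=L^2(M,\tau)$ be the completion of $M$ in the inner product $\langle x,y\rangle=\tau(x^*y)$, on which $M$ acts by left multiplication, and let $\xi\in L^2(M)$ be the image of $1\in M$. Let $e_B$ be the orthogonal projection of $L^2(M)$ onto the closed subspace $L^2(B)=\overline{B\xi}$, and let $\langle M,e_B\rangle$ be the von Neumann algebra on $L^2(M)$ generated by $M$ and $e_B$. Then $e_B$ is a central element of $B'\cap\langle M,e_B\rangle$ if and only if $B'\cap M\subseteq B$. -/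

import Mathlib

open scoped InnerProductSpace ComplexOrder

noncomputable section

namespace VonNeumannAlgebra

variable {K : Type*} [NormedAddCommGroup K] [InnerProductSpace ℂ K] [CompleteSpace K]

/-! ### A von Neumann algebra as a C⋆-algebra, with the usual order of operators -/

instance instSMulMemClass : SMulMemClass (VonNeumannAlgebra K) ℂ (K →L[ℂ] K) where
  smul_mem {s} c _ hx := s.toStarSubalgebra.smul_mem hx c

instance instIsClosed (M : VonNeumannAlgebra K) : IsClosed (M : Set (K →L[ℂ] K)) := by
  rw [← M.centralizer_centralizer]
  exact Set.isClosed_centralizer _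

instance instStarOrderedRing (M : VonNeumannAlgebra K) : StarOrderedRing M :=
  StarOrderedRing.of_nonneg_iff' (fun {x y} h z ↦ add_le_add_right (α := K →L[ℂ] K) h z)
    fun x ↦ by
      constructor
      · intro hx
        have hx' : (0 : K →L[ℂ] K) ≤ x := hx
        have hs : CFC.sqrt (x : K →L[ℂ] K) ∈ M := by
          suffices h : CFC.sqrt (x : K →L[ℂ] K) ∈ M.commutant.commutant from
            (SetLike.ext_iff.1 M.commutant_commutant _).1 h
          rw [mem_commutant_iff]
          intro g hg
          have hc : Commute (x : K →L[ℂ] K) g := mem_commutant_iff.1 hg x x.2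
          exact (hc.cfcₙ_nnreal NNReal.sqrt).symm
        refine ⟨⟨_, hs⟩, Subtype.ext ?_⟩
        have h0 : 0 ≤ CFC.sqrt (x : K →L[ℂ] K) := CFC.sqrt_nonneg _
        change (x : K →L[ℂ] K) = star (CFC.sqrt (x : K →L[ℂ] K)) * CFC.sqrt (x : K →L[ℂ] K)
        rw [(IsSelfAdjoint.of_nonneg h0).star_eq, CFC.sqrt_mul_sqrt_self _ hx']
      · rintro ⟨s, rfl⟩
        change (0 : K →L[ℂ] K) ≤ star (s : K →L[ℂ] K) * s
        exact star_mul_self_nonneg _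

/-! ### Generated von Neumann algebras -/

/-- The von Neumann algebra generated by a set `S` of operators: the double commutant of
`S ∪ S*`. -/
def generatedBy (S : Set (K →L[ℂ] K)) : VonNeumannAlgebra K where
  toStarSubalgebra := StarSubalgebra.centralizer ℂ (StarSubalgebra.centralizer ℂ S : Set (K →L[ℂ] K))
  centralizer_centralizer' := by
    change Set.centralizer (Set.centralizer (StarSubalgebra.centralizer ℂ
      (StarSubalgebra.centralizer ℂ S : Set (K →L[ℂ] K)) : Set (K →L[ℂ] K))) =
      (StarSubalgebra.centralizer ℂ (StarSubalgebra.centralizer ℂ S : Set (K →L[ℂ] K)) :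
        Set (K →L[ℂ] K))
    rw [StarSubalgebra.coe_centralizer_centralizer, Set.centralizer_centralizer_centralizer]

/-- `generatedBy S` is the smallest von Neumann algebra containing `S`. -/
theorem isLeast_generatedBy (S : Set (K →L[ℂ] K)) :
    IsLeast {N : VonNeumannAlgebra K | S ⊆ N} (generatedBy S) := by
  have key : (generatedBy S : Set (K →L[ℂ] K)) = (S ∪ star S).centralizer.centralizer :=
    StarSubalgebra.coe_centralizer_centralizer ℂ S
  refine ⟨?_, fun N hN ↦ ?_⟩
  · change S ⊆ (generatedBy S : Set (K →L[ℂ] K))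
    rw [key]
    exact Set.subset_union_left.trans Set.subset_centralizer_centralizer
  · change (generatedBy S : Set (K →L[ℂ] K)) ⊆ N
    rw [key, ← N.centralizer_centralizer]
    refine Set.centralizer_subset (Set.centralizer_subset (Set.union_subset hN fun x hx ↦ ?_))
    have h : star x ∈ N := hN hx
    simpa using star_mem h

/-! ### Traces -/

/-- A linear functional on `M` is normal (σ-weakly continuous) if it has the form
`x ↦ ∑ₙ ⟨ηₙ, x ζₙ⟩` with `∑ₙ ‖ηₙ‖² < ∞` and `∑ₙ ‖ζₙ‖² < ∞`. -/
def IsNormal {M : VonNeumannAlgebra K} (φ : M →ₗ[ℂ] ℂ) : Prop :=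
  ∃ η ζ : ℕ → K, (Summable fun n ↦ ‖η n‖ ^ 2) ∧ (Summable fun n ↦ ‖ζ n‖ ^ 2) ∧
    ∀ x : M, HasSum (fun n ↦ ⟪η n, (x : K →L[ℂ] K) (ζ n)⟫_ℂ) (φ x)

/-- A faithful normal trace `τ` on `M` with `τ 1 = 1`. -/
structure IsFaithfulNormalTrace {M : VonNeumannAlgebra K} (τ : M →ₚ[ℂ] ℂ) : Prop where
  map_one : τ 1 = 1
  map_mul_comm : ∀ x y : M, τ (x * y) = τ (y * x)
  faithful : ∀ x : M, τ (star x * x) = 0 → x = 0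
  normal : IsNormal τ.toLinearMap

/-! ### The basic construction

`L²(M, τ)` is `τ.GNS`, the completion of `M` in the inner product `⟨x, y⟩ = τ (x* y)`, on which
`M` acts by left multiplication, through `τ.gnsStarAlgHom`. -/

variable {M : VonNeumannAlgebra K}

/-- The canonical map `M → L²(M, τ)`, written `x ↦ x ξ` with `ξ` the image of `1`. -/
def toL2 (τ : M →ₚ[ℂ] ℂ) : M →ₗ[ℂ] τ.GNS :=
  (UniformSpace.Completion.toComplL (𝕜 := ℂ) (E := τ.PreGNS)).toLinearMap ∘ₗ
    τ.toPreGNS.toLinearMap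

/-- The operators on `L²(M, τ)` of left multiplication by the elements of `B ∩ M`. -/
def leftMul (τ : M →ₚ[ℂ] ℂ) (B : VonNeumannAlgebra K) : Set (τ.GNS →L[ℂ] τ.GNS) :=
  {T | ∃ x : M, (x : K →L[ℂ] K) ∈ B ∧ τ.gnsStarAlgHom x = T}

/-- `L²(B)` as a closed subspace of `L²(M, τ)`, the closure of the span of `{b ξ | b ∈ B}`. -/
def subL2 (τ : M →ₚ[ℂ] ℂ) (B : VonNeumannAlgebra K) : Submodule ℂ τ.GNS :=
  (Submodule.span ℂ {v | ∃ x : M, (x : K →L[ℂ] K) ∈ B ∧ toL2 τ x = v}).topologicalClosure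

instance (τ : M →ₚ[ℂ] ℂ) (B : VonNeumannAlgebra K) : CompleteSpace (subL2 τ B) :=
  (Submodule.isClosed_topologicalClosure _).completeSpace_coe

/-- The Jones projection `e_B`, the orthogonal projection of `L²(M, τ)` onto `L²(B)`. -/
def jonesProjection (τ : M →ₚ[ℂ] ℂ) (B : VonNeumannAlgebra K) : τ.GNS →L[ℂ] τ.GNS :=
  (subL2 τ B).starProjection

/-- The basic construction `⟨M, e_B⟩`, the von Neumann algebra on `L²(M, τ)` generated by `M`
and `e_B`. -/
def basicConstruction (τ : M →ₚ[ℂ] ℂ) (B : VonNeumannAlgebra K) : VonNeumannAlgebra τ.GNS :=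
  generatedBy (leftMul τ M ∪ {jonesProjection τ B})

/-- The relative commutant `B' ∩ ⟨M, e_B⟩`. -/
def relCommutantBasic (τ : M →ₚ[ℂ] ℂ) (B : VonNeumannAlgebra K) :
    StarSubalgebra ℂ (τ.GNS →L[ℂ] τ.GNS) :=
  StarSubalgebra.centralizer ℂ (leftMul τ B) ⊓ (basicConstruction τ B).toStarSubalgebra

/-- `e` is a central element of the algebra `N`. -/
def IsCentralIn {A : Type*} [Ring A] [StarRing A] [Algebra ℂ A] [StarModule ℂ A] (e : A)
    (N : StarSubalgebra ℂ A) : Prop :=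
  e ∈ N ∧ ∀ t ∈ N, e * t = t * e

end VonNeumannAlgebra

end

/-
The projection `e_B` always lies in `B' ∩ ⟨M, e_B⟩`. If it is central there, then it commutes with
each `x ∈ B' ∩ M`, so `e_B (xξ) = x (e_B ξ) = xξ` and `xξ ∈ L²(B)`, which forces `x ∈ B`.

Conversely, let `t ∈ B' ∩ ⟨M, e_B⟩`. It commutes with left and right multiplication by `B`, so `tξ`
is a `B`-central vector. Averaging over the unitaries of `B` shows that such vectors are limits of
vectors `yξ` with `y ∈ B' ∩ M ⊆ B`, so `tξ ∈ L²(B)` and `t (Bξ) = B (tξ) ⊆ L²(B)`. Both `t` and `t*`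
thus preserve `L²(B)`, and `t` commutes with `e_B`.

Operators on `K` and vectors of `L²(M)` are compared through the bounded `M`-linear operators
`L²(M) → K`. By normality of `τ` these are plentiful: `L²(M)` embeds into a multiple of `K`.
-/

noncomputable section

namespace BasicConstruction

open VonNeumannAlgebra ContinuousLinearMap

section HilbertSpace

/-- The fixed point is the element of least norm, which is unique. -/
theorem exists_mem_fixed_of_norm_apply_le {H : Type*} [NormedAddCommGroup H]
    [InnerProductSpace ℂ H] [CompleteSpace H] {C : Set H} (hne : C.Nonempty) (hclosed : IsClosed C)
    (hconv : Convex ℝ C) :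
    ∃ c ∈ C, ∀ f : H → H, f c ∈ C → ‖f c‖ ≤ ‖c‖ → f c = c := by
  let _ : InnerProductSpace ℝ H := InnerProductSpace.rclikeToReal ℂ H
  obtain ⟨c, hc, hmin⟩ := exists_norm_eq_iInf_of_complete_convex hne hclosed.isComplete hconv 0
  refine ⟨c, hc, fun f hfc hnorm ↦ ?_⟩
  have hobtuse : ⟪0 - c, f c - c⟫_ℝ ≤ 0 :=
    (norm_eq_iInf_iff_real_inner_le_zero hconv hc).1 hmin _ hfc
  rw [zero_sub, inner_neg_left, inner_sub_right, real_inner_self_eq_norm_sq] at hobtuse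
  have hsq : ‖f c‖ ^ 2 ≤ ‖c‖ ^ 2 := by gcongr
  have hdist : ‖f c - c‖ ^ 2 ≤ 0 := by
    rw [norm_sub_sq_real, real_inner_comm]
    linarith
  exact sub_eq_zero.1 (norm_eq_zero.1 (pow_eq_zero_iff two_ne_zero |>.1
    (le_antisymm hdist (sq_nonneg _))))

variable {𝕜 E F H : Type*} [RCLike 𝕜]
  [NormedAddCommGroup H] [InnerProductSpace 𝕜 H]

theorem commute_starProjection [CompleteSpace H] {U : Submodule 𝕜 H} [U.HasOrthogonalProjection]
    {T : H →L[𝕜] H} (hT : ∀ v ∈ U, T v ∈ U) (hT' : ∀ v ∈ U, star T v ∈ U) :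
    Commute U.starProjection T := by
  rw [ContinuousLinearMap.IsIdempotentElem.commute_iff U.isIdempotentElem_starProjection,
    Submodule.range_starProjection, Submodule.ker_starProjection]
  exact ⟨hT, orthogonal_mem_invtSubmodule hT'⟩

variable [AddCommGroup E] [Module 𝕜 E] [NormedAddCommGroup F] [NormedSpace 𝕜 F]

theorem ext_range_orthogonal [CompleteSpace H] {g : E →ₗ[𝕜] H} {S T : H →L[𝕜] F}
    (hrange : ∀ x, S (g x) = T (g x)) (horth : ∀ v ∈ g.rangeᗮ, S v = T v) : S = T := by
  let N := g.range.topologicalClosure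
  have hN : IsClosed (N : Set H) := g.range.isClosed_topologicalClosure
  have : CompleteSpace N := hN.completeSpace_coe
  have hN_eq : ∀ v ∈ N, S v = T v := by
    refine fun v hv ↦ closure_minimal (t := {v | S v = T v}) ?_
      (isClosed_eq S.continuous T.continuous) hv
    rintro _ ⟨x, rfl⟩
    exact hrange x
  ext v
  rw [← N.starProjection_add_starProjection_orthogonal v, map_add, map_add,
    hN_eq _ (N.starProjection_apply_mem v), horth _ ?_]
  rw [← g.range.orthogonal_closure]
  exact Nᗮ.starProjection_apply_mem v

theorem exists_extension_of_norm_le [CompleteSpace H] [CompleteSpace F] {f : E →ₗ[𝕜] F}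
    {g : E →ₗ[𝕜] H} {C : ℝ} (h : ∀ x, ‖f x‖ ≤ C * ‖g x‖) :
    ∃ V : H →L[𝕜] F, (∀ x, V (g x) = f x) ∧ ∀ v ∈ g.rangeᗮ, V v = 0 := by
  let N := g.range.topologicalClosure
  have hN : IsClosed (N : Set H) := g.range.isClosed_topologicalClosure
  have : CompleteSpace N := hN.completeSpace_coe
  let e : E →ₗ[𝕜] N := Submodule.inclusion g.range.le_topologicalClosure ∘ₗ g.rangeRestrict
  have he : DenseRange e :=
    ((denseRange_inclusion_iff g.range.le_topologicalClosure).2 subset_rfl).comp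
      g.surjective_rangeRestrict.denseRange (continuous_inclusion _)
  refine ⟨f.extendOfNorm e ∘L N.orthogonalProjectionOnto, fun x ↦ ?_, fun v hv ↦ ?_⟩
  · rw [comp_apply, show g x = e x from rfl, N.orthogonalProjectionOnto_mem_subspace_eq_self]
    exact LinearMap.extendOfNorm_eq he ⟨C, h⟩ x
  · rw [← g.range.orthogonal_closure] at hv
    rw [comp_apply, Submodule.orthogonalProjectionOnto_apply_of_mem_orthogonal hv, map_zero]

end HilbertSpace

section Amplification

variable {𝕜 ι H : Type*} [RCLike 𝕜] [NormedAddCommGroup H] [InnerProductSpace 𝕜 H] [CompleteSpace H]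

variable (𝕜 ι H) in
/-- The amplification `T ↦ T ⊗ 1`, sending an operator on `H` to its diagonal action on
`ℓ²(ι, H) = H ⊗ ℓ²(ι)`. -/
def amplify : (H →L[𝕜] H) →⋆ₙₐ[𝕜]
    (lp (fun _ : ι ↦ H) 2 →L[𝕜] lp (fun _ : ι ↦ H) 2) where
  toFun T := lp.mapCLM 2 (fun _ ↦ T) (norm_nonneg T) fun _ ↦ le_rfl
  map_smul' _ _ := by ext; rfl
  map_zero' := by ext; rfl
  map_add' _ _ := by ext; rfl
  map_mul' _ _ := by ext; rfl
  map_star' T := by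
    refine (eq_adjoint_iff _ _).2 fun v w ↦ ?_
    rw [lp.inner_eq_tsum, lp.inner_eq_tsum]
    exact tsum_congr fun i ↦ T.adjoint_inner_left (w i) (v i)

end Amplification

variable {K : Type*} [NormedAddCommGroup K] [InnerProductSpace ℂ K] [CompleteSpace K]
  {M : VonNeumannAlgebra K} {τ : M →ₚ[ℂ] ℂ}

section GNS

theorem inner_toL2 (x y : M) : ⟪toL2 τ x, toL2 τ y⟫_ℂ = τ (star x * y) :=
  UniformSpace.Completion.inner_coe _ _

theorem norm_toL2_sq (x : M) : (‖toL2 τ x‖ ^ 2 : ℂ) = τ (star x * x) := by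
  rw [← inner_toL2, inner_self_eq_norm_sq_to_K]
  rfl

theorem denseRange_toL2 : DenseRange (toL2 τ) :=
  UniformSpace.Completion.denseRange_coe.comp τ.toPreGNS.surjective.denseRange
    (UniformSpace.Completion.continuous_coe _)

theorem gnsStarAlgHom_toL2 (x y : M) : τ.gnsStarAlgHom x (toL2 τ y) = toL2 τ (x * y) :=
  τ.gnsNonUnitalStarAlgHom_apply_coe

theorem gnsStarAlgHom_toL2_one (x : M) : τ.gnsStarAlgHom x (toL2 τ 1) = toL2 τ x := by
  rw [gnsStarAlgHom_toL2, mul_one]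

theorem ext_toL2 {F : Type*} [NormedAddCommGroup F] [NormedSpace ℂ F] {σ : ℂ →+* ℂ}
    {S T : τ.GNS →SL[σ] F} (h : ∀ x, S (toL2 τ x) = T (toL2 τ x)) : S = T :=
  DFunLike.coe_injective (denseRange_toL2.equalizer S.continuous T.continuous (funext h))

/-- `τ` is faithful, `τ (x* x) = 0` only for `x = 0`. -/
def IsFaithful (τ : M →ₚ[ℂ] ℂ) : Prop :=
  ∀ x : M, τ (star x * x) = 0 → x = 0

theorem injective_toL2 (hfaithful : IsFaithful τ) : Function.Injective (toL2 τ) := by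
  refine (injective_iff_map_eq_zero _).2 fun x hx ↦ hfaithful x ?_
  rw [← inner_toL2, hx, inner_zero_left]

end GNS

section Intertwiners

/-- A vector that dominates the seminorm `x ↦ ‖xξ‖` embeds `L²(M, τ)` into any representation:
the operator `π(x)θ ↦ xξ` is bounded, and its adjoint is the embedding. -/
theorem exists_injective_intertwiner {H : Type*} [NormedAddCommGroup H] [InnerProductSpace ℂ H]
    [CompleteSpace H] {π : M →⋆ₙₐ[ℂ] (H →L[ℂ] H)} {θ : H} {C : ℝ}
    (h : ∀ x, ‖toL2 τ x‖ ≤ C * ‖π x θ‖) :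
    ∃ W : τ.GNS →L[ℂ] H, Function.Injective W ∧ ∀ x v, W (τ.gnsStarAlgHom x v) = π x (W v) := by
  let orbit : M →ₗ[ℂ] H := (apply ℂ H θ).toLinearMap ∘ₗ (π : M →ₗ[ℂ] H →L[ℂ] H)
  have hmul (x y : M) : π x (orbit y) = orbit (x * y) := by
    change π x (π y θ) = π (x * y) θ
    rw [map_mul, mul_apply_eq_comp]
  obtain ⟨V, hV, hV0⟩ := exists_extension_of_norm_le (f := toL2 τ) (g := orbit) h
  have hVπ (x : M) : V ∘L π x = τ.gnsStarAlgHom x ∘L V := by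
    refine ext_range_orthogonal (g := orbit) (fun y ↦ ?_) fun v hv ↦ ?_
    · rw [comp_apply, comp_apply, hmul, hV, hV, gnsStarAlgHom_toL2]
    · rw [comp_apply, comp_apply, hV0 v hv, map_zero]
      refine hV0 _ ((Submodule.mem_orthogonal _ _).2 ?_)
      rintro _ ⟨y, rfl⟩
      rw [← adjoint_inner_left, ← star_eq_adjoint, ← map_star π, hmul]
      exact hv _ ⟨_, rfl⟩
  refine ⟨V.adjoint, (injective_iff_map_eq_zero _).2 fun v hv ↦ ?_, fun x v ↦ ?_⟩
  · refine denseRange_toL2.eq_zero_of_inner_right ℂ fun x ↦ ?_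
    rw [← hV, ← adjoint_inner_right, hv, inner_zero_right]
  · have hVstar : V ∘L (π x).adjoint = (τ.gnsStarAlgHom x).adjoint ∘L V := by
      simpa only [map_star] using! hVπ (star x)
    have hadj : V.adjoint ∘L τ.gnsStarAlgHom x = π x ∘L V.adjoint := by
      simpa only [adjoint_comp, adjoint_adjoint] using (congrArg adjoint hVstar).symm
    exact DFunLike.congr_fun hadj v

theorem exists_norm_toL2_le_amplify (hnormal : IsNormal τ.toLinearMap) :
    ∃ θ : lp (fun _ : ℕ ↦ K) 2, ∀ x : M, ‖toL2 τ x‖ ≤ ‖amplify ℂ ℕ K (x : K →L[ℂ] K) θ‖ := by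
  obtain ⟨η, ζ, hη, hζ, hsum⟩ := hnormal
  let a : lp (fun _ : ℕ ↦ K) 2 := ⟨η, memℓp_gen (by simpa using hη)⟩
  let b : lp (fun _ : ℕ ↦ K) 2 := ⟨ζ, memℓp_gen (by simpa using hζ)⟩
  refine ⟨a + b, fun x ↦ ?_⟩
  set A := amplify ℂ ℕ K (x : K →L[ℂ] K)
  have hinner : τ (star x * x) = ⟪A a, A b⟫_ℂ := by
    rw [lp.inner_eq_tsum]
    refine (hsum (star x * x)).tsum_eq.symm.trans (tsum_congr fun n ↦ ?_)
    exact (x : K →L[ℂ] K).adjoint_inner_right (η n) ((x : K →L[ℂ] K) (ζ n))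
  have hnorm : ‖toL2 τ x‖ ^ 2 = RCLike.re ⟪A a, A b⟫_ℂ := by
    rw [← hinner, ← inner_toL2, inner_self_eq_norm_sq]
  rw [← sq_le_sq₀ (norm_nonneg _) (norm_nonneg _), hnorm, map_add, norm_add_sq (𝕜 := ℂ)]
  nlinarith [norm_sub_sq (𝕜 := ℂ) (A a) (A b), sq_nonneg ‖A a - A b‖, sq_nonneg ‖A a‖,
    sq_nonneg ‖A b‖]

variable (τ) in
/-- The bounded `M`-linear operators `S : L²(M, τ) → K`. Since `S (xξ) = x (Sξ)`, they correspond
to the vectors `Sξ` for which `xξ ↦ x (Sξ)` is bounded. -/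
def intertwiners : Submodule ℂ (τ.GNS →L[ℂ] K) where
  carrier := {S | ∀ (x : M) (v : τ.GNS), S (τ.gnsStarAlgHom x v) = (x : K →L[ℂ] K) (S v)}
  zero_mem' x _ := (map_zero (x : K →L[ℂ] K)).symm
  add_mem' hS hT x v := by rw [add_apply, hS, hT, add_apply, map_add]
  smul_mem' c S hS x v := by rw [smul_apply, hS, smul_apply, map_smul]

theorem intertwiner_toL2 {S : τ.GNS →L[ℂ] K} (hS : S ∈ intertwiners τ) (x : M) :
    S (toL2 τ x) = (x : K →L[ℂ] K) (S (toL2 τ 1)) := by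
  rw [← hS, gnsStarAlgHom_toL2_one]

theorem comp_mem_intertwiners {T : K →L[ℂ] K} (hT : T ∈ M.commutant) {S : τ.GNS →L[ℂ] K}
    (hS : S ∈ intertwiners τ) : T ∘L S ∈ intertwiners τ := fun x v ↦ by
  rw [comp_apply, hS, comp_apply]
  exact (DFunLike.congr_fun (mem_commutant_iff.1 hT x x.2) (S v)).symm

theorem eq_zero_of_forall_intertwiner (hnormal : IsNormal τ.toLinearMap) {v : τ.GNS}
    (hv : ∀ S ∈ intertwiners τ, S v = 0) : v = 0 := by
  obtain ⟨θ, hθ⟩ := exists_norm_toL2_le_amplify hnormal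
  obtain ⟨W, hinj, hW⟩ := exists_injective_intertwiner (τ := τ) (C := 1) (θ := θ)
    (π := (amplify ℂ ℕ K).comp (NonUnitalStarSubalgebraClass.subtype M)) fun x ↦ by
      rw [one_mul]
      exact hθ x
  refine hinj ?_
  ext n
  rw [map_zero]
  refine hv (lp.evalCLM ℂ (fun _ : ℕ ↦ K) 2 n ∘L W) fun x w ↦ ?_
  rw [comp_apply, hW]
  rfl

theorem mem_of_forall_commutant_comm {N : VonNeumannAlgebra K} {x : K →L[ℂ] K}
    (h : ∀ T ∈ N.commutant, T * x = x * T) : x ∈ N := by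
  rwa [← N.commutant_commutant, mem_commutant_iff]

variable (τ) in
/-- The evaluation `S ↦ Sv` of intertwiners at a vector. -/
def evalIntertwiner (v : τ.GNS) : intertwiners τ →ₗ[ℂ] K :=
  (apply ℂ K v).toLinearMap ∘ₗ (intertwiners τ).subtype

theorem denseRange_evalIntertwiner_one (hfaithful : IsFaithful τ)
    (hnormal : IsNormal τ.toLinearMap) : DenseRange (evalIntertwiner τ (toL2 τ 1)) := by
  let U := (evalIntertwiner τ (toL2 τ 1)).range.topologicalClosure
  have hinv {T : K →L[ℂ] K} (hT : T ∈ M.commutant) (v : K) (hv : v ∈ U) : T v ∈ U := by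
    refine map_mem_closure T.continuous hv ?_
    rintro _ ⟨S, rfl⟩
    exact ⟨⟨_, comp_mem_intertwiners hT S.2⟩, rfl⟩
  have hU : U.starProjection ∈ M := mem_of_forall_commutant_comm fun T hT ↦
    (commute_starProjection (hinv hT) (hinv (star_mem hT))).symm
  have hvanish : toL2 τ (⟨_, hU⟩ - 1) = 0 := by
    refine eq_zero_of_forall_intertwiner hnormal fun S hS ↦ ?_
    rw [intertwiner_toL2 hS]
    change U.starProjection (S (toL2 τ 1)) - S (toL2 τ 1) = 0
    rw [sub_eq_zero, Submodule.starProjection_eq_self_iff]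
    exact Submodule.le_topologicalClosure _ ⟨⟨S, hS⟩, rfl⟩
  have hone : U.starProjection = 1 := congrArg Subtype.val
    (sub_eq_zero.1 ((injective_iff_map_eq_zero _).1 (injective_toL2 hfaithful) _ hvanish))
  intro v
  exact Submodule.starProjection_eq_self_iff.1 (DFunLike.congr_fun hone v)

theorem isClosed_toL2_image_closedBall (hfaithful : IsFaithful τ)
    (hnormal : IsNormal τ.toLinearMap) (r : ℝ) :
    IsClosed (toL2 τ '' Metric.closedBall 0 r) := by
  refine isClosed_of_closure_subset fun c hc ↦ ?_
  have hr : 0 ≤ r := by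
    obtain ⟨_, x, hx, -⟩ := closure_nonempty_iff.1 ⟨c, hc⟩
    exact Metric.nonempty_closedBall.1 ⟨x, hx⟩
  let ev := evalIntertwiner τ
  have hbound (S : intertwiners τ) : ‖ev c S‖ ≤ r * ‖ev (toL2 τ 1) S‖ := by
    have hcl : IsClosed {v : τ.GNS | ‖S.1 v‖ ≤ r * ‖S.1 (toL2 τ 1)‖} :=
      isClosed_le S.1.continuous.norm continuous_const
    refine closure_minimal ?_ hcl hc
    rintro _ ⟨x, hx, rfl⟩
    rw [Set.mem_ofPred_eq, intertwiner_toL2 S.2]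
    exact (x : K →L[ℂ] K).le_of_opNorm_le (mem_closedBall_zero_iff.1 hx) _
  have hdense := denseRange_evalIntertwiner_one hfaithful hnormal
  let y : K →L[ℂ] K := (ev c).extendOfNorm (ev (toL2 τ 1))
  have hy (S : τ.GNS →L[ℂ] K) (hS : S ∈ intertwiners τ) : y (S (toL2 τ 1)) = S c :=
    LinearMap.extendOfNorm_eq (f := ev c) hdense ⟨r, hbound⟩ ⟨S, hS⟩
  have hyM : y ∈ M := by
    refine mem_of_forall_commutant_comm fun T hT ↦ DFunLike.coe_injective ?_
    refine hdense.equalizer (T * y).continuous (y * T).continuous (funext fun S ↦ ?_)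
    exact (congrArg T (hy S S.2)).trans (hy _ (comp_mem_intertwiners hT S.2)).symm
  refine ⟨⟨y, hyM⟩, mem_closedBall_zero_iff.2 ?_, ?_⟩
  · exact LinearMap.opNorm_extendOfNorm_le (f := ev c) hdense hr hbound
  · refine sub_eq_zero.1 (eq_zero_of_forall_intertwiner hnormal fun S hS ↦ ?_)
    rw [map_sub, intertwiner_toL2 hS, sub_eq_zero]
    exact hy S hS

end Intertwiners

section ModularConjugation

/-- `τ` is a trace, `τ (x y) = τ (y x)`. -/
def IsTracial (τ : M →ₚ[ℂ] ℂ) : Prop :=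
  ∀ x y : M, τ (x * y) = τ (y * x)

theorem IsTracial.norm_toL2_star (htr : IsTracial τ) (x : M) :
    ‖toL2 τ (star x)‖ = ‖toL2 τ x‖ := by
  rw [← sq_eq_sq₀ (norm_nonneg _) (norm_nonneg _), ← Complex.ofReal_inj]
  push_cast
  rw [norm_toL2_sq, norm_toL2_sq, star_star, htr]

variable (τ) in
/-- The canonical conjugation `J : xξ ↦ x*ξ` of `L²(M, τ)`, for a trace `τ`. -/
def modularConj : τ.GNS →L⋆[ℂ] τ.GNS :=
  (toL2 τ ∘ₛₗ (starLinearEquiv ℂ : M ≃ₗ⋆[ℂ] M).toLinearMap).extendOfNorm (toL2 τ)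

theorem modularConj_toL2 (htr : IsTracial τ) (x : M) :
    modularConj τ (toL2 τ x) = toL2 τ (star x) :=
  LinearMap.extendOfNorm_eq denseRange_toL2 ⟨1, fun y ↦ by
    rw [one_mul]
    exact (htr.norm_toL2_star y).le⟩ x

theorem norm_modularConj_le (htr : IsTracial τ) (v : τ.GNS) : ‖modularConj τ v‖ ≤ ‖v‖ := by
  refine (LinearMap.norm_extendOfNorm_apply_le denseRange_toL2 1 (fun y ↦ ?_) v).trans_eq
    (one_mul _)
  rw [one_mul]
  exact (htr.norm_toL2_star y).le

variable (τ) in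
/-- Right multiplication `xξ ↦ (xb)ξ` on `L²(M, τ)`, for a trace `τ`. It is encoded as `J b* J`,
which shows that it is bounded. -/
def rightMul (b : M) : τ.GNS →L[ℂ] τ.GNS :=
  modularConj τ ∘SL τ.gnsStarAlgHom (star b) ∘SL modularConj τ

theorem rightMul_toL2 (htr : IsTracial τ) (b x : M) :
    rightMul τ b (toL2 τ x) = toL2 τ (x * b) := by
  change modularConj τ (τ.gnsStarAlgHom (star b) (modularConj τ (toL2 τ x))) = _
  rw [modularConj_toL2 htr, gnsStarAlgHom_toL2, modularConj_toL2 htr, star_mul, star_star,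
    star_star]

theorem star_rightMul (htr : IsTracial τ) (b : M) :
    star (rightMul τ b) = rightMul τ (star b) := by
  refine ext_toL2 fun x ↦ denseRange_toL2.eq_of_inner_right ℂ fun y ↦ ?_
  rw [star_eq_adjoint, adjoint_inner_right, rightMul_toL2 htr, rightMul_toL2 htr, inner_toL2,
    inner_toL2, star_mul, mul_assoc, htr, mul_assoc]

theorem commute_gnsStarAlgHom_rightMul (htr : IsTracial τ) (x b : M) :
    Commute (τ.gnsStarAlgHom x) (rightMul τ b) := by
  refine ext_toL2 fun y ↦ ?_
  simp only [mul_apply_eq_comp, rightMul_toL2 htr, gnsStarAlgHom_toL2, mul_assoc]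

end ModularConjugation

section Subalgebra

variable {B : VonNeumannAlgebra K}

theorem coe_subL2 : (subL2 τ B : Set τ.GNS) = closure (toL2 τ '' {x | (x : K →L[ℂ] K) ∈ B}) := by
  have hspan : Submodule.span ℂ {v | ∃ x : M, (x : K →L[ℂ] K) ∈ B ∧ toL2 τ x = v} =
      (B.toStarSubalgebra.toSubalgebra.toSubmodule.comap
        M.toStarSubalgebra.toSubalgebra.toSubmodule.subtype).map (toL2 τ) :=
    Submodule.span_eq (Submodule.map (toL2 τ) (B.toStarSubalgebra.toSubalgebra.toSubmodule.comap
      M.toStarSubalgebra.toSubalgebra.toSubmodule.subtype))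
  rw [subL2, hspan, Submodule.topologicalClosure_coe]
  rfl

theorem toL2_mem_subL2 {x : M} (hx : (x : K →L[ℂ] K) ∈ B) : toL2 τ x ∈ subL2 τ B :=
  Submodule.le_topologicalClosure _ (Submodule.subset_span ⟨x, hx, rfl⟩)

theorem apply_mem_subL2 {T : τ.GNS →L[ℂ] τ.GNS}
    (hT : ∀ x : M, (x : K →L[ℂ] K) ∈ B → T (toL2 τ x) ∈ subL2 τ B) {v : τ.GNS}
    (hv : v ∈ subL2 τ B) : T v ∈ subL2 τ B := by
  rw [← SetLike.mem_coe, coe_subL2] at hv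
  have hclosed : IsClosed (subL2 τ B : Set τ.GNS) := Submodule.isClosed_topologicalClosure _
  refine closure_minimal ?_ (hclosed.preimage T.continuous) hv
  rintro _ ⟨x, hx, rfl⟩
  exact hT x hx

theorem gnsStarAlgHom_apply_mem_subL2 {b : M} (hb : (b : K →L[ℂ] K) ∈ B) {v : τ.GNS}
    (hv : v ∈ subL2 τ B) : τ.gnsStarAlgHom b v ∈ subL2 τ B := by
  refine apply_mem_subL2 (fun x hx ↦ ?_) hv
  rw [gnsStarAlgHom_toL2]
  exact toL2_mem_subL2 (mul_mem hb hx)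

theorem rightMul_apply_mem_subL2 (htr : IsTracial τ) {b : M} (hb : (b : K →L[ℂ] K) ∈ B)
    {v : τ.GNS} (hv : v ∈ subL2 τ B) : rightMul τ b v ∈ subL2 τ B := by
  refine apply_mem_subL2 (fun x hx ↦ ?_) hv
  rw [rightMul_toL2 htr]
  exact toL2_mem_subL2 (mul_mem hx hb)

theorem commute_jonesProjection_gnsStarAlgHom {b : M} (hb : (b : K →L[ℂ] K) ∈ B) :
    Commute (jonesProjection τ B) (τ.gnsStarAlgHom b) := by
  refine commute_starProjection (fun v ↦ gnsStarAlgHom_apply_mem_subL2 hb) ?_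
  rw [← map_star]
  exact fun v ↦ gnsStarAlgHom_apply_mem_subL2 (star_mem hb)

theorem commute_jonesProjection_rightMul (htr : IsTracial τ) {b : M}
    (hb : (b : K →L[ℂ] K) ∈ B) : Commute (jonesProjection τ B) (rightMul τ b) := by
  refine commute_starProjection (fun v ↦ rightMul_apply_mem_subL2 htr hb) ?_
  rw [star_rightMul htr]
  exact fun v ↦ rightMul_apply_mem_subL2 htr (star_mem hb)

/-- For `T ∈ B'` the matrix coefficients `⟪S'ξ, T x Sξ⟫` and `⟪S'ξ, x T Sξ⟫` are continuous in the
vector `xξ`, since the second one is `⟪S'(J xξ), T Sξ⟫`. They agree for `x ∈ B`. -/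
theorem mem_of_toL2_mem_subL2 (hτ : IsFaithfulNormalTrace τ) {x : M}
    (hx : toL2 τ x ∈ subL2 τ B) : (x : K →L[ℂ] K) ∈ B := by
  refine mem_of_forall_commutant_comm fun T hT ↦ ?_
  have hcoeff (S S' : intertwiners τ) (y : M) :
      ⟪S'.1 (modularConj τ (toL2 τ y)), T (S.1 (toL2 τ 1))⟫_ℂ =
        ⟪S'.1 (toL2 τ 1), (y : K →L[ℂ] K) (T (S.1 (toL2 τ 1)))⟫_ℂ := by
    rw [modularConj_toL2 hτ.map_mul_comm, intertwiner_toL2 S'.2]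
    exact adjoint_inner_left _ _ _
  have hlim (S S' : intertwiners τ) : ⟪S'.1 (toL2 τ 1), T (S.1 (toL2 τ x))⟫_ℂ =
      ⟪S'.1 (modularConj τ (toL2 τ x)), T (S.1 (toL2 τ 1))⟫_ℂ := by
    rw [← SetLike.mem_coe, coe_subL2] at hx
    refine closure_minimal (t := {v | ⟪S'.1 (toL2 τ 1), T (S.1 v)⟫_ℂ =
      ⟪S'.1 (modularConj τ v), T (S.1 (toL2 τ 1))⟫_ℂ}) ?_
      (isClosed_eq (by fun_prop) (by fun_prop)) hx
    rintro _ ⟨b, hb, rfl⟩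
    rw [Set.mem_ofPred_eq, hcoeff, intertwiner_toL2 S.2, ← mul_apply_eq_comp, ← mul_apply_eq_comp,
      mem_commutant_iff.1 hT b hb]
  have hdense := denseRange_evalIntertwiner_one hτ.faithful hτ.normal
  refine DFunLike.coe_injective (hdense.equalizer (T * (x : K →L[ℂ] K)).continuous
    ((x : K →L[ℂ] K) * T).continuous (funext fun S ↦ ?_))
  refine hdense.eq_of_inner_right ℂ fun S' ↦ ?_
  refine Eq.trans ?_ ((hlim S S').trans (hcoeff S S' x))
  rw [intertwiner_toL2 S.2]
  rfl

end Subalgebra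

section RelativeCommutant

variable {B : VonNeumannAlgebra K}

theorem commute_of_mem_generatedBy {S : Set (K →L[ℂ] K)} {r t : K →L[ℂ] K}
    (hr : ∀ s ∈ S, Commute s r) (hr' : ∀ s ∈ S, Commute (star s) r) (ht : t ∈ generatedBy S) :
    Commute r t :=
  ((StarSubalgebra.mem_centralizer_iff ℂ).1 ht r
    ((StarSubalgebra.mem_centralizer_iff ℂ).2 fun s hs ↦ ⟨hr s hs, hr' s hs⟩)).1

theorem commute_rightMul_of_mem_basicConstruction (htr : IsTracial τ) {b : M}
    (hb : (b : K →L[ℂ] K) ∈ B) {t : τ.GNS →L[ℂ] τ.GNS} (ht : t ∈ basicConstruction τ B) :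
    Commute (rightMul τ b) t := by
  refine commute_of_mem_generatedBy ?_ ?_ ht
  · rintro _ (⟨x, -, rfl⟩ | rfl)
    exacts [commute_gnsStarAlgHom_rightMul htr x b, commute_jonesProjection_rightMul htr hb]
  · rintro _ (⟨x, -, rfl⟩ | rfl)
    · rw [← map_star]
      exact commute_gnsStarAlgHom_rightMul htr (star x) b
    · rw [jonesProjection, (isSelfAdjoint_starProjection (subL2 τ B)).star_eq]
      exact commute_jonesProjection_rightMul htr hb

theorem mem_relCommutantBasic_of_commute {t : τ.GNS →L[ℂ] τ.GNS}
    (hcomm : ∀ b : M, (b : K →L[ℂ] K) ∈ B → Commute (τ.gnsStarAlgHom b) t)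
    (ht : t ∈ leftMul τ M ∪ {jonesProjection τ B}) : t ∈ relCommutantBasic τ B := by
  refine ⟨(StarSubalgebra.mem_centralizer_iff ℂ).2 ?_, (isLeast_generatedBy _).1 ht⟩
  rintro _ ⟨b, hb, rfl⟩
  rw [← map_star]
  exact ⟨hcomm b hb, hcomm (star b) (star_mem hb)⟩

theorem jonesProjection_mem_relCommutantBasic : jonesProjection τ B ∈ relCommutantBasic τ B :=
  mem_relCommutantBasic_of_commute (fun _ hb ↦ (commute_jonesProjection_gnsStarAlgHom hb).symm)
    (Or.inr rfl)

theorem gnsStarAlgHom_mem_relCommutantBasic {x : M} (hx : (x : K →L[ℂ] K) ∈ B.commutant) :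
    τ.gnsStarAlgHom x ∈ relCommutantBasic τ B :=
  mem_relCommutantBasic_of_commute (fun b hb ↦ Commute.map (f := τ.gnsStarAlgHom)
    (Subtype.ext (mem_commutant_iff.1 hx b hb))) (Or.inl ⟨x, x.2, rfl⟩)

theorem commute_gnsStarAlgHom_of_mem_relCommutantBasic {t : τ.GNS →L[ℂ] τ.GNS}
    (ht : t ∈ relCommutantBasic τ B) {b : M} (hb : (b : K →L[ℂ] K) ∈ B) :
    Commute (τ.gnsStarAlgHom b) t :=
  ((StarSubalgebra.mem_centralizer_iff ℂ).1 ht.1 _ ⟨b, hb, rfl⟩).1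

end RelativeCommutant

section CentralVectors

variable {B : VonNeumannAlgebra K}

variable (τ B) in
/-- A vector `v` of `L²(M, τ)` is `B`-central if `b v = v b` for all `b ∈ B`. -/
def IsCentralVector (v : τ.GNS) : Prop :=
  ∀ b : M, (b : K →L[ℂ] K) ∈ B → τ.gnsStarAlgHom b v = rightMul τ b v

variable (τ) in
/-- The conjugation `v ↦ u v u*` on `L²(M, τ)`, which extends `xξ ↦ (u x u*)ξ`. -/
def conjL2 (u : M) : τ.GNS →L[ℂ] τ.GNS :=
  τ.gnsStarAlgHom u ∘L rightMul τ (star u)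

theorem conjL2_toL2 (htr : IsTracial τ) (u x : M) :
    conjL2 τ u (toL2 τ x) = toL2 τ (u * x * star u) := by
  rw [conjL2, comp_apply, rightMul_toL2 htr, gnsStarAlgHom_toL2, mul_assoc]

theorem norm_conjL2_apply_le (htr : IsTracial τ) {u : M} (hu : u ∈ unitary M) (v : τ.GNS) :
    ‖conjL2 τ u v‖ ≤ ‖v‖ := by
  have hnorm (w : τ.GNS) : ‖τ.gnsStarAlgHom u w‖ = ‖w‖ :=
    norm_map_of_mem_unitary (Unitary.map_mem τ.gnsStarAlgHom hu) w
  change ‖τ.gnsStarAlgHom u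
    (modularConj τ (τ.gnsStarAlgHom (star (star u)) (modularConj τ v)))‖ ≤ ‖v‖
  rw [hnorm, star_star]
  exact (norm_modularConj_le htr _).trans ((hnorm _).trans_le (norm_modularConj_le htr v))

theorem IsCentralVector.conjL2_apply {v : τ.GNS} (hv : IsCentralVector τ B v) {u : M}
    (hu : u ∈ unitary M) (huB : (u : K →L[ℂ] K) ∈ B) : conjL2 τ u v = v := by
  rw [conjL2, comp_apply, ← hv (star u) (star_mem huB), ← mul_apply_eq_comp, ← map_mul,
    Unitary.mul_star_self_of_mem hu, map_one, one_apply_eq_self]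

theorem mem_commutant_of_forall_unitary {y : K →L[ℂ] K}
    (h : ∀ u ∈ unitary B, (u : K →L[ℂ] K) * y = y * u) : y ∈ B.commutant := by
  have hB := LinearMap.ext_on (CStarAlgebra.span_unitary B)
    (f := LinearMap.mulRight ℂ y ∘ₗ B.toStarSubalgebra.toSubalgebra.toSubmodule.subtype)
    (g := LinearMap.mulLeft ℂ y ∘ₗ B.toStarSubalgebra.toSubalgebra.toSubmodule.subtype) h
  exact mem_commutant_iff.2 fun b hb ↦ DFunLike.congr_fun hB ⟨b, hb⟩

/-- The set of the `yξ` with `‖y‖ ≤ ‖x‖` and `‖yξ - v‖ ≤ ‖xξ - v‖` is closed, convex and invariant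
under conjugation by the unitaries of `B`, so its element of least norm is fixed by them. -/
theorem IsCentralVector.exists_commutant_dist_le (hτ : IsFaithfulNormalTrace τ) (hBM : B ≤ M)
    {v : τ.GNS} (hv : IsCentralVector τ B v) (x : M) :
    ∃ y : M, (y : K →L[ℂ] K) ∈ B.commutant ∧ dist (toL2 τ y) v ≤ dist (toL2 τ x) v := by
  obtain ⟨_, ⟨⟨y, hy, rfl⟩, hyv⟩, hfix⟩ := exists_mem_fixed_of_norm_apply_le
    (C := toL2 τ '' Metric.closedBall 0 ‖x‖ ∩ Metric.closedBall v (dist (toL2 τ x) v))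
    ⟨_, ⟨x, by simp, rfl⟩, Metric.mem_closedBall.2 le_rfl⟩
    ((isClosed_toL2_image_closedBall hτ.faithful hτ.normal ‖x‖).inter Metric.isClosed_closedBall)
    (((convex_closedBall 0 ‖x‖).linear_image ((toL2 τ).restrictScalars ℝ)).inter
      (convex_closedBall _ _))
  refine ⟨y, mem_commutant_of_forall_unitary fun u hu ↦ ?_, hyv⟩
  let w : M := ⟨u, hBM u.2⟩
  have hw : w ∈ unitary M := by
    rw [Unitary.mem_iff, Subtype.ext_iff, Subtype.ext_iff] at hu ⊢
    exact hu
  have hnorm := norm_conjL2_apply_le (τ := τ) hτ.map_mul_comm hw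
  have hmem_ball : conjL2 τ w (toL2 τ y) ∈ toL2 τ '' Metric.closedBall 0 ‖x‖ := by
    refine ⟨_, ?_, (conjL2_toL2 hτ.map_mul_comm w y).symm⟩
    rw [mem_closedBall_zero_iff] at hy ⊢
    rwa [CStarRing.norm_mul_mem_unitary _ (Unitary.star_mem hw),
      CStarRing.norm_mem_unitary_mul _ hw]
  have hdist : dist (conjL2 τ w (toL2 τ y)) v ≤ dist (toL2 τ x) v := by
    refine le_trans ?_ hyv
    nth_rw 1 [← hv.conjL2_apply hw u.2]
    rw [dist_eq_norm, dist_eq_norm, ← map_sub]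
    exact hnorm _
  have hconj : w * y * star w = y := injective_toL2 hτ.faithful <|
    (conjL2_toL2 hτ.map_mul_comm w y).symm.trans (hfix _ ⟨hmem_ball, hdist⟩ (hnorm _))
  have hcomm : w * y = y * w := by
    conv_rhs => rw [← hconj, mul_assoc, Unitary.star_mul_self_of_mem hw, mul_one]
  exact congrArg Subtype.val hcomm

theorem IsCentralVector.mem_closure_commutant (hτ : IsFaithfulNormalTrace τ) (hBM : B ≤ M)
    {v : τ.GNS} (hv : IsCentralVector τ B v) :
    v ∈ closure (toL2 τ '' {y | (y : K →L[ℂ] K) ∈ B.commutant}) := by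
  refine Metric.mem_closure_iff.2 fun ε hε ↦ ?_
  obtain ⟨x, hx⟩ := denseRange_toL2.exists_dist_lt v hε
  obtain ⟨y, hy, hyv⟩ := hv.exists_commutant_dist_le hτ hBM x
  exact ⟨_, ⟨y, hy, rfl⟩, by
    rw [dist_comm] at hx ⊢
    exact hyv.trans_lt hx⟩

theorem isCentralVector_apply_toL2_one (htr : IsTracial τ) {t : τ.GNS →L[ℂ] τ.GNS}
    (ht : t ∈ relCommutantBasic τ B) : IsCentralVector τ B (t (toL2 τ 1)) := fun b hb ↦ by
  rw [← mul_apply_eq_comp, ← mul_apply_eq_comp,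
    commute_gnsStarAlgHom_of_mem_relCommutantBasic ht hb,
    commute_rightMul_of_mem_basicConstruction htr hb ht.2, mul_apply_eq_comp, mul_apply_eq_comp,
    gnsStarAlgHom_toL2, rightMul_toL2 htr, mul_one, one_mul]

theorem relCommutantBasic_apply_mem_subL2 (hτ : IsFaithfulNormalTrace τ) (hBM : B ≤ M)
    (h : (B.commutant : Set (K →L[ℂ] K)) ∩ M ⊆ B) {t : τ.GNS →L[ℂ] τ.GNS}
    (ht : t ∈ relCommutantBasic τ B) {v : τ.GNS} (hv : v ∈ subL2 τ B) : t v ∈ subL2 τ B := by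
  have hone : t (toL2 τ 1) ∈ subL2 τ B := by
    rw [← SetLike.mem_coe, coe_subL2]
    exact closure_mono (Set.image_mono fun (y : M) hy ↦ h ⟨hy, y.2⟩)
      ((isCentralVector_apply_toL2_one hτ.map_mul_comm ht).mem_closure_commutant hτ hBM)
  refine apply_mem_subL2 (fun b hb ↦ ?_) hv
  rw [← gnsStarAlgHom_toL2_one, ← mul_apply_eq_comp,
    ← commute_gnsStarAlgHom_of_mem_relCommutantBasic ht hb, mul_apply_eq_comp]
  exact gnsStarAlgHom_apply_mem_subL2 hb hone

theorem toL2_mem_subL2_of_commute_jonesProjection {x : M}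
    (h : Commute (jonesProjection τ B) (τ.gnsStarAlgHom x)) : toL2 τ x ∈ subL2 τ B := by
  have hone : jonesProjection τ B (toL2 τ 1) = toL2 τ 1 :=
    Submodule.starProjection_eq_self_iff.2 (toL2_mem_subL2 (one_mem B))
  refine Submodule.starProjection_eq_self_iff.1 ?_
  calc jonesProjection τ B (toL2 τ x)
      = (jonesProjection τ B * τ.gnsStarAlgHom x) (toL2 τ 1) := by
        rw [mul_apply_eq_comp, gnsStarAlgHom_toL2_one]
    _ = toL2 τ x := by rw [h.eq, mul_apply_eq_comp, hone, gnsStarAlgHom_toL2_one]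

end CentralVectors

end BasicConstruction

end

theorem corollary3p3 {K : Type*} [NormedAddCommGroup K] [InnerProductSpace ℂ K] [CompleteSpace K]
    (M : VonNeumannAlgebra K) (τ : M →ₚ[ℂ] ℂ)
    (hτ : VonNeumannAlgebra.IsFaithfulNormalTrace τ)
    (B : VonNeumannAlgebra K) (hBM : B ≤ M) :
    VonNeumannAlgebra.IsCentralIn (VonNeumannAlgebra.jonesProjection τ B)
        (VonNeumannAlgebra.relCommutantBasic τ B) ↔
      (B.commutant : Set (K →L[ℂ] K)) ∩ M ⊆ B := by
  open VonNeumannAlgebra BasicConstruction in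
  refine ⟨fun ⟨_, hcentral⟩ x ⟨hxB, hxM⟩ ↦ ?_, fun h ↦
    ⟨jonesProjection_mem_relCommutantBasic, fun t ht ↦ ?_⟩⟩
  · have hcomm : Commute (jonesProjection τ B) (τ.gnsStarAlgHom ⟨x, hxM⟩) :=
      hcentral _ (gnsStarAlgHom_mem_relCommutantBasic hxB)
    exact mem_of_toL2_mem_subL2 hτ (toL2_mem_subL2_of_commute_jonesProjection hcomm)
  · exact commute_starProjection (fun v ↦ relCommutantBasic_apply_mem_subL2 hτ hBM h ht)
      fun v ↦ relCommutantBasic_apply_mem_subL2 hτ hBM h (star_mem ht)
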